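/- Let $U\subseteq\mathbb R^5$ be open, with coordinates $u=(x^1,x^2,x^3,y^4=v,y^5)$, indices $i,j,k=1,2,3$ and $a,b,c,d=4,5$. Let $g_1=\pm1$, let $g_2,g_3$ be nowhere vanishing $C^2$ functions on $U$ of $(x^2,x^3)$ only, $h_4,h_5$ nowhere vanishing $C^2$ functions on $U$ of $(x^i,v)$ only, and $w_i,n_i$ $C^2$ functions on $U$ of $(x^i,v)$ only. Consider the metric $$g_1(dx^1)^2+g_2(dx^2)^2+g_3(dx^3)^2+h_4(\delta v)^2+h_5(\delta y^5)^2,\qquad \delta v=dv+w_i\,dx^i,\quad \delta y^5=dy^5+n_i\,dx^i,$$ and the anholonomic frame $\delta_i=\partial_i-N_i^a\partial_a$, $\delta_a=\partial_a$ dual to $(dx^i,\delta v,\delta y^5)$, where $N_i^4=w_i$ and $N_i^5=n_i$, with anholonomy coefficients $\delta_\alpha\delta_\beta-\delta_\beta\delta_\alpha=w^\gamma_{\alpha\beta}\delta_\gamma$. Write $g_{ij}=\mathrm{diag}(g_1,g_2,g_3)$ and $h_{ab}=\mathrm{diag}(h_4,h_5)$. All components below refer to this frame. The connection $D_{\delta_\gamma}\delta_\beta=\Gamma^\alpha_{\beta\gamma}\delta_\alpha$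 is the canonical d-connection, whose nonzero components are $$L^i_{jk}=\tfrac12g^{im}(\delta_kg_{mj}+\delta_jg_{mk}-\delta_mg_{jk}),\qquad C^i_{jc}=\tfrac12g^{ik}\partial_cg_{jk},$$ $$L^a_{bk}=\partial_bN^a_k+\tfrac12h^{ac}\bigl(\delta_kh_{bc}-h_{dc}\partial_bN^d_k-h_{db}\partial_cN^d_k\bigr),\qquad C^a_{bc}=\tfrac12h^{ad}(\partial_ch_{db}+\partial_bh_{dc}-\partial_dh_{bc}).$$ The curvature $R_\beta{}^\alpha{}_{\gamma\tau}$ is defined by $R(\delta_\tau,\delta_\gamma)\delta_\beta=R_\beta{}^\alpha{}_{\gamma\tau}\delta_\alpha$, the Ricci tensor by $R_{\beta\gamma}=R_\beta{}^\alpha{}_{\gamma\alpha}$, and $R$ is its metric trace. The vertical components $R_{ab}$ are also written $S_{ab}$. Write $a^\bullet=\partial a/\partial x^2$, $a'=\partial a/\partial x^3$, $a^*=\partial a/\partial v$. Then the following holds on $U$. (a) With $\alpha_i=\partial_ih_5^*-h_5^*\,\partial_i\ln\sqrt{|h_4h_5|}$, $\beta=h_5^{**}-h_5^*\,[\ln\sqrt{|h_4h_5|}]^*$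 and $\gamma=\frac{3h_5^*}{2h_5}-\frac{h_4^*}{2h_4}$, $$R^2_2=R^3_3=-\frac1{2g_2g_3}\Bigl[g_3^{\bullet\bullet}-\frac{g_2^\bullet g_3^\bullet}{2g_2}-\frac{(g_3^\bullet)^2}{2g_3}+g_2''-\frac{g_2'g_3'}{2g_3}-\frac{(g_2')^2}{2g_2}\Bigr],\qquad S^4_4=S^5_5=-\frac{\beta}{2h_4h_5},$$ $$R_{4i}=w_i\frac{\beta}{2h_5}-\frac{\alpha_i}{2h_5},\qquad R_{5i}=-\frac{h_5}{2h_4}\bigl[n_i^{**}+\gamma n_i^*\bigr].$$ (b) At every point, the vacuum Einstein equations $R_{\alpha\beta}=0$ are equivalent to the system $R^2_2=R^3_3=0$, $S^4_4=S^5_5=0$, $R_{4i}=0$, $R_{5i}=0$ $(i=1,2,3)$. (c) Let $\kappa\in\mathbb R$ and let $\Upsilon_{\alpha\beta}$ be an energy–momentum tensor that is diagonal in the anholonomic frame. At every point at which $$\Upsilon^1_1=\Upsilon^2_2+\Upsilon^4_4,\qquad \Upsilon^2_2=\Upsilon^3_3,\qquad \Upsilon^4_4=\Upsilon^5_5,$$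 the Einstein equations $R_{\alpha\beta}-\frac12g_{\alpha\beta}R=\kappa\Upsilon_{\alpha\beta}$ are equivalent to $$R^2_2=R^3_3=-\Upsilon_4,\qquad S^4_4=S^5_5=-\Upsilon_2,\qquad R_{4i}=0,\qquad R_{5i}=0\quad(i=1,2,3),$$ where $\Upsilon_2=\kappa\Upsilon^2_2$ and $\Upsilon_4=\kappa\Upsilon^4_4$. Conversely, if $\kappa\neq0$, the Einstein equations with a diagonal source can hold at a point only if the source satisfies the three displayed conditions there. -/

import Mathlib

open scoped BigOperators

namespace AnholonomicGravity

noncomputable section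

/-- Coordinate and frame indices `(i, a)`: three horizontal ones, `i = 1, 2, 3`, and two
vertical ones, `a = 4, 5`. -/
abbrev Idx := Fin 3 ⊕ Fin 2

/-- The index 1 (holonomic coordinate `x¹`). -/
abbrev x1 : Idx := Sum.inl 0

/-- The index 2 (holonomic coordinate `x²`). -/
abbrev x2 : Idx := Sum.inl 1

/-- The index 3 (holonomic coordinate `x³`). -/
abbrev x3 : Idx := Sum.inl 2

/-- The index 4 (anholonomic coordinate `y⁴ = v`). -/
abbrev y4 : Idx := Sum.inr 0

/-- The index 5 (coordinate `y⁵`). -/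
abbrev y5 : Idx := Sum.inr 1

/-- Coordinate tuples `u = (x¹, x², x³, v, y⁵)`. -/
abbrev Pt := Idx → ℝ

/-- The function `f` on `U` is a function of the coordinates with index in `s` only. -/
def DependsOnlyOn (U : Set Pt) (f : Pt → ℝ) (s : Set Idx) : Prop :=
  ∀ u ∈ U, ∀ u' ∈ U, (∀ α ∈ s, u α = u' α) → f u = f u'

/-- The coordinate partial derivative `∂f/∂u^α`. -/
def pd (α : Idx) (f : Pt → ℝ) : Pt → ℝ :=
  fun u => fderiv ℝ f u (Pi.single α 1)

/-- The data of a d-metric: the horizontal block `g_{ij}`, the vertical block `h_{ab}` and the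
N-coefficients `N a i = N_i^a`. They stand for the metric
`g_{ij} dx^i dx^j + h_{ab} δy^a δy^b` with `δy^a = dy^a + N_i^a dx^i`. -/
structure DMetric where
  g : Pt → Matrix (Fin 3) (Fin 3) ℝ
  h : Pt → Matrix (Fin 2) (Fin 2) ℝ
  N : Fin 2 → Fin 3 → Pt → ℝ

namespace DMetric

variable (M : DMetric)

/-- The N-elongated derivatives, dual to the co-frame `(dx^i, δy^a)`:
`δ_i = ∂_i - N_i^b ∂_b` and `δ_a = ∂_a`. -/
def delta : Idx → (Pt → ℝ) → Pt → ℝ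
  | Sum.inl i, f => fun u => pd (Sum.inl i) f u - ∑ b, M.N b i u * pd (Sum.inr b) f u
  | Sum.inr a, f => pd (Sum.inr a) f

/-- The anholonomy coefficients `anh γ α β = w_{αβ}^γ`, that is
`δ_α δ_β - δ_β δ_α = w_{αβ}^γ δ_γ`. -/
def anh : Idx → Idx → Idx → Pt → ℝ
  | Sum.inr a, Sum.inl i, Sum.inl j =>
      fun u => M.delta (Sum.inl j) (M.N a i) u - M.delta (Sum.inl i) (M.N a j) u
  | Sum.inr b, Sum.inl j, Sum.inr a => fun u => pd (Sum.inr a) (M.N b j) u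
  | Sum.inr b, Sum.inr a, Sum.inl j => fun u => -pd (Sum.inr a) (M.N b j) u
  | _, _, _ => fun _ => 0

/-- The components of the metric in the N-elongated frame. -/
def metric (u : Pt) : Matrix Idx Idx ℝ :=
  Matrix.fromBlocks (M.g u) 0 0 (M.h u)

/-- The inverse metric in the N-elongated frame. -/
def invMetric (u : Pt) : Matrix Idx Idx ℝ :=
  Matrix.fromBlocks (M.g u)⁻¹ 0 0 (M.h u)⁻¹

/-- The canonical d-connection, `D_{δ_γ} δ_β = Γ^α_{βγ} δ_α` with `Gam α β γ = Γ^α_{βγ}`; its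
components are `L^i_{jk}`, `L^a_{bk}`, `C^i_{jc}`, `C^a_{bc}`, in this order. -/
def Gam : Idx → Idx → Idx → Pt → ℝ
  | Sum.inl i, Sum.inl j, Sum.inl k => fun u =>
      (1 / 2) * ∑ m, (M.g u)⁻¹ i m *
        (M.delta (Sum.inl k) (fun p => M.g p m j) u
          + M.delta (Sum.inl j) (fun p => M.g p m k) u
          - M.delta (Sum.inl m) (fun p => M.g p j k) u)
  | Sum.inr a, Sum.inr b, Sum.inl k => fun u =>
      pd (Sum.inr b) (M.N a k) u
        + (1 / 2) * ∑ c, (M.h u)⁻¹ a c *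
          (M.delta (Sum.inl k) (fun p => M.h p b c) u
            - ∑ d, M.h u d c * pd (Sum.inr b) (M.N d k) u
            - ∑ d, M.h u d b * pd (Sum.inr c) (M.N d k) u)
  | Sum.inl i, Sum.inl j, Sum.inr c => fun u =>
      (1 / 2) * ∑ k, (M.g u)⁻¹ i k * pd (Sum.inr c) (fun p => M.g p j k) u
  | Sum.inr a, Sum.inr b, Sum.inr c => fun u =>
      (1 / 2) * ∑ d, (M.h u)⁻¹ a d *
        (pd (Sum.inr c) (fun p => M.h p d b) u
          + pd (Sum.inr b) (fun p => M.h p d c) u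
          - pd (Sum.inr d) (fun p => M.h p b c) u)
  | _, _, _ => fun _ => 0

/-- The curvature of the canonical d-connection, `R(δ_τ, δ_γ) δ_β = R_β{}^α{}_{γτ} δ_α`, with
`curv β α γ τ = R_β{}^α{}_{γτ}`. -/
def curv (β α γ τ : Idx) (u : Pt) : ℝ :=
  M.delta τ (M.Gam α β γ) u - M.delta γ (M.Gam α β τ) u
    + ∑ φ, (M.Gam φ β γ u * M.Gam α φ τ u - M.Gam φ β τ u * M.Gam α φ γ u
      + M.Gam α β φ u * M.anh φ γ τ u)

/-- The Ricci tensor `R_{βγ} = R_β{}^α{}_{γα}` in the N-elongated frame (in general not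
symmetric). Its vertical components `R_{ab}` are also written `S_{ab}`. -/
def ricci (β γ : Idx) (u : Pt) : ℝ := ∑ α, M.curv β α γ α u

/-- The mixed components `R^α_β` of the Ricci tensor; the vertical ones are also written
`S^a_b`. -/
def ricciUp (α β : Idx) (u : Pt) : ℝ := ∑ γ, M.invMetric u α γ * M.ricci γ β u

/-- The scalar curvature. -/
def scalarCurv (u : Pt) : ℝ := ∑ β, ∑ γ, M.invMetric u β γ * M.ricci β γ u

/-- The vacuum Einstein equations at `u`. -/
def VacuumEq (u : Pt) : Prop := ∀ α β, M.ricci α β u = 0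

/-- The Einstein equations with coupling constant `κ` and energy–momentum tensor
`T α β = Υ_{αβ}` (components in the N-elongated frame) at `u`. -/
def EinsteinEq (κ : ℝ) (T : Idx → Idx → Pt → ℝ) (u : Pt) : Prop :=
  ∀ α β, M.ricci α β u - (1 / 2) * M.metric u α β * M.scalarCurv u = κ * T α β u

/-- The mixed components `Υ^α_β` of the energy–momentum tensor `T α β = Υ_{αβ}`. -/
def sourceUp (T : Idx → Idx → Pt → ℝ) (α β : Idx) (u : Pt) : ℝ :=
  ∑ γ, M.invMetric u α γ * T γ β u

/-- `Υ^1_1 = Υ^2_2 + Υ^4_4`, `Υ^2_2 = Υ^3_3` and `Υ^4_4 = Υ^5_5`. -/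
def SourceCond (T : Idx → Idx → Pt → ℝ) (u : Pt) : Prop :=
  M.sourceUp T x1 x1 u = M.sourceUp T x2 x2 u + M.sourceUp T y4 y4 u ∧
  M.sourceUp T x2 x2 u = M.sourceUp T x3 x3 u ∧
  M.sourceUp T y4 y4 u = M.sourceUp T y5 y5 u

/-- The reduced system `R^2_2 = R^3_3 = -Υ₄`, `S^4_4 = S^5_5 = -Υ₂`, `R_{4i} = 0`, `R_{5i} = 0`
at `u`, with right-hand sides `s2 = Υ₂` and `s4 = Υ₄`. -/
def ReducedSystem (s2 s4 : ℝ) (u : Pt) : Prop :=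
  (M.ricciUp x2 x2 u = -s4 ∧ M.ricciUp x3 x3 u = -s4) ∧
  (M.ricciUp y4 y4 u = -s2 ∧ M.ricciUp y5 y5 u = -s2) ∧
  (∀ i : Fin 3, M.ricci y4 (Sum.inl i) u = 0) ∧
  (∀ i : Fin 3, M.ricci y5 (Sum.inl i) u = 0)

end DMetric

/-- The d-metric `g₁ (dx¹)² + g₂ (dx²)² + g₃ (dx³)² + h₄ (δv)² + h₅ (δy⁵)²` with
`δv = dv + w_i dx^i` and `δy⁵ = dy⁵ + n_i dx^i`. -/
def ansatz (g1 : ℝ) (g2 g3 h4 h5 : Pt → ℝ) (w n : Fin 3 → Pt → ℝ) : DMetric where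
  g u := Matrix.diagonal ![g1, g2 u, g3 u]
  h u := Matrix.diagonal ![h4 u, h5 u]
  N := ![w, n]

/-- `-(1/(2 g₂ g₃)) [g₃^{••} - g₂^• g₃^•/(2 g₂) - (g₃^•)²/(2 g₃)
+ g₂'' - g₂' g₃'/(2 g₃) - (g₂')²/(2 g₂)]`, with `• = ∂/∂x²` and `' = ∂/∂x³`. -/
def hExpr (g2 g3 : Pt → ℝ) (u : Pt) : ℝ :=
  -(1 / (2 * g2 u * g3 u)) *
    (pd x2 (pd x2 g3) u - pd x2 g2 u * pd x2 g3 u / (2 * g2 u) - (pd x2 g3 u) ^ 2 / (2 * g3 u)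
      + pd x3 (pd x3 g2) u - pd x3 g2 u * pd x3 g3 u / (2 * g3 u)
      - (pd x3 g2 u) ^ 2 / (2 * g2 u))

/-- `ln √|h₄ h₅|`. -/
def logDet (h4 h5 : Pt → ℝ) (u : Pt) : ℝ := Real.log (Real.sqrt |h4 u * h5 u|)

/-- `α_i = ∂_i h₅^* - h₅^* ∂_i ln √|h₄ h₅|`, with `* = ∂/∂v`. -/
def alphaCoef (h4 h5 : Pt → ℝ) (i : Fin 3) (u : Pt) : ℝ :=
  pd (Sum.inl i) (pd y4 h5) u - pd y4 h5 u * pd (Sum.inl i) (logDet h4 h5) u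

/-- `β = h₅^{**} - h₅^* (ln √|h₄ h₅|)^*`. -/
def betaCoef (h4 h5 : Pt → ℝ) (u : Pt) : ℝ :=
  pd y4 (pd y4 h5) u - pd y4 h5 u * pd y4 (logDet h4 h5) u

/-- `γ = 3 h₅^*/(2 h₅) - h₄^*/(2 h₄)`. -/
def gammaCoef (h4 h5 : Pt → ℝ) (u : Pt) : ℝ :=
  3 * pd y4 h5 u / (2 * h5 u) - pd y4 h4 u / (2 * h4 u)

end

end AnholonomicGravity

open AnholonomicGravity

/-! The canonical d-connection never mixes horizontal and vertical directions, so the Ricci tensor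
splits into four blocks, each computed from few coefficients. Since `g2`, `g3` have no vertical
derivatives, `C^i_{jc} = 0` and the `L^i_{jk}` are the Christoffel symbols of `g₂ (dx²)² + g₃
(dx³)²`. Hence `R_{ic} = 0`, and `R_{ij}` is the Ricci tensor of a surface, with nothing in the
direction `x¹`. Likewise `R_{ab}` is the Ricci tensor of the two-dimensional fibre metric `h`. In
dimension two the Ricci tensor is a multiple of the metric, so these blocks are governed by two
scalars, `R^2_2 = R^3_3 = K` and `S^4_4 = S^5_5 = σ`. Only `R_{ai}` remains, and only there does the
anholonomy enter.

The scalar curvature is therefore `2K + 2σ`, and the diagonal of the mixed Einstein tensor is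
`-(K+σ), -σ, -σ, -K, -K`. These entries satisfy the three relations imposed on the source, whatever
`K` and `σ` are. So for `κ ≠ 0` the relations are necessary, and when they hold the five diagonal
equations reduce to two.

The blocks are computed in `ricci_horizontal`, `ricci_horizontal_vertical`, `ricci_vertical`,
`ricci_y4_horizontal` and `ricci_y5_horizontal`; `einsteinEq_iff` assembles them. -/

namespace AnholonomicGravity

open Filter Topology

/-! ### Calculus of the coordinate partial derivatives -/

section PartialDerivatives

variable {U : Set Pt} {f f' : Pt → ℝ} {u : Pt} {s : Set Idx}

/-- The closed forms of the connection coefficients hold only on `U`; openness allows them to be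
differentiated there. -/
theorem pd_congr (hU : IsOpen U) (hu : u ∈ U) (h : ∀ p ∈ U, f p = f' p) (α : Idx) :
    pd α f u = pd α f' u := by
  have : f =ᶠ[𝓝 u] f' := by
    filter_upwards [hU.mem_nhds hu] with p hp using h p hp
  simp only [pd, this.fderiv_eq]

theorem pd_const (α : Idx) (c : ℝ) : pd α (fun _ => c) u = 0 := by
  simp [pd]

theorem pd_zero_of_eqOn (hU : IsOpen U) (hu : u ∈ U) (h : ∀ p ∈ U, f p = 0) (α : Idx) :
    pd α f u = 0 := by
  rw [pd_congr hU hu h α, pd_const]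

theorem pd_neg (α : Idx) : pd α (fun p => -f p) u = -pd α f u := by
  simp only [pd, fderiv_fun_neg, neg_apply]

theorem pd_const_mul (α : Idx) (c : ℝ) (hf : DifferentiableAt ℝ f u) :
    pd α (fun p => c * f p) u = c * pd α f u := by
  simp only [pd, fderiv_const_mul hf, smul_apply, smul_eq_mul]

theorem pd_sub (α : Idx) (hf : DifferentiableAt ℝ f u) (hf' : DifferentiableAt ℝ f' u) :
    pd α (fun p => f p - f' p) u = pd α f u - pd α f' u := by
  simp only [pd, fderiv_fun_sub hf hf', sub_apply]

theorem pd_mul (α : Idx) (hf : DifferentiableAt ℝ f u) (hf' : DifferentiableAt ℝ f' u) :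
    pd α (fun p => f p * f' p) u = f u * pd α f' u + pd α f u * f' u := by
  simp only [pd, fderiv_fun_mul hf hf', add_apply,
    smul_apply, smul_eq_mul]
  ring

theorem differentiableAt_div_two_mul (hf : DifferentiableAt ℝ f u)
    (hf' : DifferentiableAt ℝ f' u) (h0 : f' u ≠ 0) :
    DifferentiableAt ℝ (fun p => f p / (2 * f' p)) u := by
  simp only [div_eq_mul_inv]
  exact hf.mul ((hf'.const_mul 2).inv (mul_ne_zero two_ne_zero h0))

/-- Nearly all connection coefficients of the ansatz are quotients of this shape. The rule follows
by applying the product rule to `f = (f / (2 f')) * (2 f')`, valid near `u`, and solving for the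
derivative of the quotient. -/
theorem pd_div_two_mul (α : Idx) (hf : DifferentiableAt ℝ f u) (hf' : DifferentiableAt ℝ f' u)
    (h0 : f' u ≠ 0) :
    pd α (fun p => f p / (2 * f' p)) u
      = pd α f u / (2 * f' u) - f u * pd α f' u / (2 * f' u ^ 2) := by
  have dq : DifferentiableAt ℝ (fun p => f p / (2 * f' p)) u :=
    differentiableAt_div_two_mul hf hf' h0
  have hz : ∀ᶠ p in 𝓝 u, f' p ≠ 0 := hf'.continuousAt.eventually_ne h0
  have e : f =ᶠ[𝓝 u] fun p => (f p / (2 * f' p)) * (2 * f' p) := by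
    filter_upwards [hz] with p hp
    field_simp
  have key : pd α f u = pd α (fun p => (f p / (2 * f' p)) * (2 * f' p)) u := by
    simp only [pd, e.fderiv_eq]
  rw [pd_mul α dq (hf'.const_mul 2), pd_const_mul α 2 hf'] at key
  rw [key]
  field_simp
  ring

/-- `Real.log` ignores signs, so `ln √|h₄ h₅|` is half of `Real.log (h₄ h₅)` and no case distinction
on the signature is needed. -/
theorem pd_logDet {h4 h5 : Pt → ℝ} (α : Idx) (d4 : DifferentiableAt ℝ h4 u)
    (d5 : DifferentiableAt ℝ h5 u) (z4 : h4 u ≠ 0) (z5 : h5 u ≠ 0) :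
    pd α (logDet h4 h5) u = pd α h4 u / (2 * h4 u) + pd α h5 u / (2 * h5 u) := by
  have e : logDet h4 h5 = fun p => (1 / 2) * Real.log (h4 p * h5 p) := by
    funext p
    rw [logDet, Real.log_sqrt (abs_nonneg _), Real.log_abs]
    ring
  have z : h4 u * h5 u ≠ 0 := mul_ne_zero z4 z5
  have dm : DifferentiableAt ℝ (fun p => h4 p * h5 p) u := d4.mul d5
  rw [e, pd_const_mul α _ (dm.log z)]
  have l : pd α (fun p => Real.log (h4 p * h5 p)) u
      = (h4 u * h5 u)⁻¹ * pd α (fun p => h4 p * h5 p) u := by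
    simp only [pd, (dm.hasFDerivAt.log z).fderiv, smul_apply, smul_eq_mul]
  rw [l, pd_mul α d4 d5]
  field_simp
  ring

theorem differentiableAt_of_contDiffOn (hU : IsOpen U) (hf : ContDiffOn ℝ 2 f U) (hu : u ∈ U) :
    DifferentiableAt ℝ f u :=
  (hf.contDiffAt (hU.mem_nhds hu)).differentiableAt (by norm_num)

theorem differentiableAt_pd (hU : IsOpen U) (hf : ContDiffOn ℝ 2 f U) (hu : u ∈ U) (α : Idx) :
    DifferentiableAt ℝ (pd α f) u := by
  have h : DifferentiableAt ℝ (fderiv ℝ f) u :=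
    ((hf.contDiffAt (hU.mem_nhds hu)).fderiv_right (m := 1) (by norm_num)).differentiableAt
      (by norm_num)
  exact h.clm_apply (differentiableAt_const _)

theorem pd_comm (hU : IsOpen U) (hf : ContDiffOn ℝ 2 f U) (hu : u ∈ U) (α β : Idx) :
    pd α (pd β f) u = pd β (pd α f) u := by
  have h : DifferentiableAt ℝ (fderiv ℝ f) u :=
    ((hf.contDiffAt (hU.mem_nhds hu)).fderiv_right (m := 1) (by norm_num)).differentiableAt
      (by norm_num)
  have e : ∀ α β : Idx, pd α (pd β f) u
      = fderiv ℝ (fderiv ℝ f) u (Pi.single α 1) (Pi.single β 1) := by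
    intro α β
    change fderiv ℝ (fun p => fderiv ℝ f p (Pi.single β 1)) u _ = _
    rw [fderiv_clm_apply h (differentiableAt_const _)]
    simp
  rw [e, e]
  exact ((hf.contDiffAt (hU.mem_nhds hu)).isSymmSndFDerivAt (by simp)) _ _

/-- For small `t` the point `u + t e_α` stays in `U` and differs from `u` only in a coordinate
outside `s`, so `f` is constant on a short segment. -/
theorem pd_eq_zero_of_dependsOnlyOn (hU : IsOpen U) (hf : DifferentiableAt ℝ f u)
    (hs : DependsOnlyOn U f s) (hu : u ∈ U) {α : Idx} (hα : α ∉ s) : pd α f u = 0 := by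
  have hl : pd α f u = lineDeriv ℝ f u (Pi.single α 1) := (hf.lineDeriv_eq_fderiv).symm
  rw [hl, lineDeriv]
  have ev : (fun t : ℝ => f (u + t • Pi.single α (1 : ℝ))) =ᶠ[𝓝 0] fun _ => f u := by
    have c : Tendsto (fun t : ℝ => u + t • Pi.single α (1 : ℝ)) (𝓝 0) (𝓝 u) := by
      have : Continuous fun t : ℝ => u + t • (Pi.single α (1 : ℝ) : Pt) := by fun_prop
      simpa using this.tendsto 0
    filter_upwards [c (hU.mem_nhds hu)] with t ht
    refine hs _ ht _ hu fun β hβ => ?_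
    have : β ≠ α := fun h => hα (h ▸ hβ)
    simp [Pi.single_eq_of_ne this]
  rw [ev.deriv_eq, deriv_const]

/-- Exchanging the two derivatives leaves the `β`-derivative of a function that vanishes on all of
`U`. -/
theorem pd_pd_eq_zero_of_dependsOnlyOn (hU : IsOpen U) (hf : ContDiffOn ℝ 2 f U)
    (hs : DependsOnlyOn U f s) (hu : u ∈ U) {α : Idx} (hα : α ∉ s) (β : Idx) :
    pd α (pd β f) u = 0 := by
  rw [pd_comm hU hf hu]
  exact pd_zero_of_eqOn hU hu (fun p hp => pd_eq_zero_of_dependsOnlyOn hU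
    (differentiableAt_of_contDiffOn hU hf hp) hs hp hα) β

end PartialDerivatives

end AnholonomicGravity

namespace AnholonomicGravity

/-! ### The canonical d-connection of the ansatz -/

/-- The standing assumptions on the coefficient functions of the ansatz. -/
structure IsRegularAnsatz (U : Set Pt) (g1 : ℝ) (g2 g3 h4 h5 : Pt → ℝ) (w n : Fin 3 → Pt → ℝ) :
    Prop where
  isOpen : IsOpen U
  z1 : g1 ≠ 0
  c2 : ContDiffOn ℝ 2 g2 U
  c3 : ContDiffOn ℝ 2 g3 U
  c4 : ContDiffOn ℝ 2 h4 U
  c5 : ContDiffOn ℝ 2 h5 U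
  cw : ∀ i, ContDiffOn ℝ 2 (w i) U
  cn : ∀ i, ContDiffOn ℝ 2 (n i) U
  d2 : DependsOnlyOn U g2 {x2, x3}
  d3 : DependsOnlyOn U g3 {x2, x3}
  d4 : DependsOnlyOn U h4 {x1, x2, x3, y4}
  d5 : DependsOnlyOn U h5 {x1, x2, x3, y4}
  dw : ∀ i, DependsOnlyOn U (w i) {x1, x2, x3, y4}
  dn : ∀ i, DependsOnlyOn U (n i) {x1, x2, x3, y4}
  z2 : ∀ u ∈ U, g2 u ≠ 0
  z3 : ∀ u ∈ U, g3 u ≠ 0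
  z4 : ∀ u ∈ U, h4 u ≠ 0
  z5 : ∀ u ∈ U, h5 u ≠ 0

/-- The horizontal components `L^i_{jk}` for the ansatz: the Christoffel symbols of
`g₂ (dx²)² + g₃ (dx³)²`. -/
noncomputable def horChristoffel (g2 g3 : Pt → ℝ) : Fin 3 → Fin 3 → Fin 3 → Pt → ℝ
  | 1, 1, 1 => fun p => pd x2 g2 p / (2 * g2 p)
  | 1, 1, 2 => fun p => pd x3 g2 p / (2 * g2 p)
  | 1, 2, 1 => fun p => pd x3 g2 p / (2 * g2 p)
  | 1, 2, 2 => fun p => -(pd x2 g3 p / (2 * g2 p))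
  | 2, 2, 2 => fun p => pd x3 g3 p / (2 * g3 p)
  | 2, 1, 2 => fun p => pd x2 g3 p / (2 * g3 p)
  | 2, 2, 1 => fun p => pd x2 g3 p / (2 * g3 p)
  | 2, 1, 1 => fun p => -(pd x3 g2 p / (2 * g3 p))
  | _, _, _ => fun _ => 0

/-- The vertical components `C^a_{bc}` for the ansatz. -/
noncomputable def verChristoffel (h4 h5 : Pt → ℝ) : Fin 2 → Fin 2 → Fin 2 → Pt → ℝ
  | 0, 0, 0 => fun p => pd y4 h4 p / (2 * h4 p)
  | 0, 1, 1 => fun p => -(pd y4 h5 p / (2 * h4 p))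
  | 1, 0, 1 => fun p => pd y4 h5 p / (2 * h5 p)
  | 1, 1, 0 => fun p => pd y4 h5 p / (2 * h5 p)
  | _, _, _ => fun _ => 0

/-- The mixed components `L^a_{bk}` for the ansatz. -/
noncomputable def mixedCoef (h4 h5 : Pt → ℝ) (w n : Fin 3 → Pt → ℝ) (k : Fin 3) :
    Fin 2 → Fin 2 → Pt → ℝ
  | 0, 0 => fun p => (pd (Sum.inl k) h4 p - w k p * pd y4 h4 p) / (2 * h4 p)
  | 0, 1 => fun p => -((h5 p * pd y4 (n k) p) / (2 * h4 p))
  | 1, 0 => fun p => (1 / 2) * pd y4 (n k) p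
  | 1, 1 => fun p => (pd (Sum.inl k) h5 p - w k p * pd y4 h5 p) / (2 * h5 p)

theorem inv_diagonal_of_ne_zero {ι : Type*} [Fintype ι] [DecidableEq ι] (v : ι → ℝ)
    (hv : ∀ i, v i ≠ 0) : (Matrix.diagonal v)⁻¹ = Matrix.diagonal fun i => (v i)⁻¹ := by
  refine Matrix.inv_eq_right_inv ?_
  rw [Matrix.diagonal_mul_diagonal, ← Matrix.diagonal_one]
  congr 1
  funext i
  exact mul_inv_cancel₀ (hv i)

namespace IsRegularAnsatz

variable {U : Set Pt} {g1 : ℝ} {g2 g3 h4 h5 : Pt → ℝ} {w n : Fin 3 → Pt → ℝ} {u : Pt}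

theorem inv_g (H : IsRegularAnsatz U g1 g2 g3 h4 h5 w n) (hu : u ∈ U) :
    ((ansatz g1 g2 g3 h4 h5 w n).g u)⁻¹
      = Matrix.diagonal ![g1⁻¹, (g2 u)⁻¹, (g3 u)⁻¹] := by
  have := inv_diagonal_of_ne_zero ![g1, g2 u, g3 u]
    (by intro i; fin_cases i <;> simp [H.z1, H.z2 u hu, H.z3 u hu])
  refine this.trans (congrArg _ ?_)
  funext i
  fin_cases i <;> rfl

theorem inv_h (H : IsRegularAnsatz U g1 g2 g3 h4 h5 w n) (hu : u ∈ U) :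
    ((ansatz g1 g2 g3 h4 h5 w n).h u)⁻¹ = Matrix.diagonal ![(h4 u)⁻¹, (h5 u)⁻¹] := by
  have := inv_diagonal_of_ne_zero ![h4 u, h5 u]
    (by intro i; fin_cases i <;> simp [H.z4 u hu, H.z5 u hu])
  refine this.trans (congrArg _ ?_)
  funext i
  fin_cases i <;> rfl

theorem pd_g2 (H : IsRegularAnsatz U g1 g2 g3 h4 h5 w n) (hu : u ∈ U) {α : Idx}
    (hα : α ∉ ({x2, x3} : Set Idx)) : pd α g2 u = 0 :=
  pd_eq_zero_of_dependsOnlyOn H.isOpen (differentiableAt_of_contDiffOn H.isOpen H.c2 hu) H.d2 hu hα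

theorem pd_g3 (H : IsRegularAnsatz U g1 g2 g3 h4 h5 w n) (hu : u ∈ U) {α : Idx}
    (hα : α ∉ ({x2, x3} : Set Idx)) : pd α g3 u = 0 :=
  pd_eq_zero_of_dependsOnlyOn H.isOpen (differentiableAt_of_contDiffOn H.isOpen H.c3 hu) H.d3 hu hα

theorem pd_y5 (hU : IsOpen U) {f : Pt → ℝ} (c : ContDiffOn ℝ 2 f U)
    (d : DependsOnlyOn U f {x1, x2, x3, y4}) (hu : u ∈ U) : pd y5 f u = 0 :=
  pd_eq_zero_of_dependsOnlyOn hU (differentiableAt_of_contDiffOn hU c hu) d hu (by simp)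

/-- The metric block `g` has no vertical derivatives, so each `δ_k` acts on it as `∂_k`, and the
coefficients `w`, `n` disappear. -/
theorem Gam_horizontal (H : IsRegularAnsatz U g1 g2 g3 h4 h5 w n) (hu : u ∈ U) (i j k : Fin 3) :
    (ansatz g1 g2 g3 h4 h5 w n).Gam (Sum.inl i) (Sum.inl j) (Sum.inl k) u
      = horChristoffel g2 g3 i j k u := by
  have z2 := H.z2 u hu
  have z3 := H.z3 u hu
  have a1 : pd x1 g2 u = 0 := H.pd_g2 hu (by simp)
  have a4 : pd y4 g2 u = 0 := H.pd_g2 hu (by simp)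
  have a5 : pd y5 g2 u = 0 := H.pd_g2 hu (by simp)
  have b1 : pd x1 g3 u = 0 := H.pd_g3 hu (by simp)
  have b4 : pd y4 g3 u = 0 := H.pd_g3 hu (by simp)
  have b5 : pd y5 g3 u = 0 := H.pd_g3 hu (by simp)
  simp only [DMetric.Gam, H.inv_g hu]
  fin_cases i <;> fin_cases j <;> fin_cases k <;>
    simp [Fin.sum_univ_three, ansatz, DMetric.delta, pd_const, horChristoffel, a1, a4, a5, b1, b4,
      b5] <;> field_simp

theorem Gam_vertical (H : IsRegularAnsatz U g1 g2 g3 h4 h5 w n) (hu : u ∈ U) (a b c : Fin 2) :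
    (ansatz g1 g2 g3 h4 h5 w n).Gam (Sum.inr a) (Sum.inr b) (Sum.inr c) u
      = verChristoffel h4 h5 a b c u := by
  have z4 := H.z4 u hu
  have z5 := H.z5 u hu
  have a5 : pd y5 h4 u = 0 := pd_y5 H.isOpen H.c4 H.d4 hu
  have b5 : pd y5 h5 u = 0 := pd_y5 H.isOpen H.c5 H.d5 hu
  simp only [DMetric.Gam, H.inv_h hu]
  fin_cases a <;> fin_cases b <;> fin_cases c <;>
    simp [ansatz, pd_const, verChristoffel, a5, b5] <;> field_simp

/-- In `L^4_{4k}` the term `w_k^*` is cancelled by the two halves subtracted inside the bracket; in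
`L^5_{4k}` only one half of `n_k^*` is subtracted, so half of it survives. -/
theorem Gam_mixed (H : IsRegularAnsatz U g1 g2 g3 h4 h5 w n) (hu : u ∈ U) (a b : Fin 2)
    (k : Fin 3) :
    (ansatz g1 g2 g3 h4 h5 w n).Gam (Sum.inr a) (Sum.inr b) (Sum.inl k) u
      = mixedCoef h4 h5 w n k a b u := by
  have z4 := H.z4 u hu
  have z5 := H.z5 u hu
  have a5 : pd y5 h4 u = 0 := pd_y5 H.isOpen H.c4 H.d4 hu
  have b5 : pd y5 h5 u = 0 := pd_y5 H.isOpen H.c5 H.d5 hu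
  have w5 : pd y5 (w k) u = 0 := pd_y5 H.isOpen (H.cw k) (H.dw k) hu
  have n5 : pd y5 (n k) u = 0 := pd_y5 H.isOpen (H.cn k) (H.dn k) hu
  simp only [DMetric.Gam, H.inv_h hu]
  fin_cases a <;> fin_cases b <;>
    simp [ansatz, DMetric.delta, pd_const, mixedCoef, a5, b5, w5, n5] <;> field_simp <;> ring

theorem Gam_horizontal_vertical (H : IsRegularAnsatz U g1 g2 g3 h4 h5 w n) (hu : u ∈ U)
    (i j : Fin 3) (c : Fin 2) :
    (ansatz g1 g2 g3 h4 h5 w n).Gam (Sum.inl i) (Sum.inl j) (Sum.inr c) u = 0 := by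
  have a : ∀ c : Fin 2, pd (Sum.inr c) g2 u = 0 := fun c => H.pd_g2 hu (by simp)
  have b : ∀ c : Fin 2, pd (Sum.inr c) g3 u = 0 := fun c => H.pd_g3 hu (by simp)
  simp only [DMetric.Gam]
  have e : ∀ k, pd (Sum.inr c) (fun p => (ansatz g1 g2 g3 h4 h5 w n).g p j k) u = 0 := by
    intro k
    fin_cases j <;> fin_cases k <;> simp [ansatz, pd_const, a, b]
  simp [e]

end IsRegularAnsatz

end AnholonomicGravity

namespace AnholonomicGravity

/-! ### The Ricci tensor of the ansatz -/

theorem DMetric.delta_congr (M : DMetric) {U : Set Pt} (hU : IsOpen U) {u : Pt} (hu : u ∈ U)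
    {f f' : Pt → ℝ} (h : ∀ p ∈ U, f p = f' p) (τ : Idx) : M.delta τ f u = M.delta τ f' u := by
  cases τ <;> simp only [DMetric.delta, pd_congr hU hu h]

theorem DMetric.delta_const (M : DMetric) (τ : Idx) (c : ℝ) (u : Pt) :
    M.delta τ (fun _ => c) u = 0 := by
  cases τ <;> simp [DMetric.delta, pd_const]

namespace IsRegularAnsatz

variable {U : Set Pt} {g1 : ℝ} {g2 g3 h4 h5 : Pt → ℝ} {w n : Fin 3 → Pt → ℝ} {u : Pt}

/-- A vertical contraction index contributes nothing because the connection preserves the splitting.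
The commutator of `δ_i` and `δ_k` is vertical, so its term carries a factor `C^i_{jc} = 0`. -/
theorem ricci_horizontal_eq (H : IsRegularAnsatz U g1 g2 g3 h4 h5 w n) (hu : u ∈ U)
    (j k : Fin 3) :
    (ansatz g1 g2 g3 h4 h5 w n).ricci (Sum.inl j) (Sum.inl k) u
      = ∑ i, ((ansatz g1 g2 g3 h4 h5 w n).delta (Sum.inl i) (horChristoffel g2 g3 i j k) u
        - (ansatz g1 g2 g3 h4 h5 w n).delta (Sum.inl k) (horChristoffel g2 g3 i j i) u
        + ∑ m, (horChristoffel g2 g3 m j k u * horChristoffel g2 g3 i m i u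
          - horChristoffel g2 g3 m j i u * horChristoffel g2 g3 i m k u)) := by
  have e : ∀ (τ : Idx) (i j k : Fin 3),
      (ansatz g1 g2 g3 h4 h5 w n).delta τ
        ((ansatz g1 g2 g3 h4 h5 w n).Gam (Sum.inl i) (Sum.inl j) (Sum.inl k)) u
      = (ansatz g1 g2 g3 h4 h5 w n).delta τ (horChristoffel g2 g3 i j k) u := fun τ i j k =>
    DMetric.delta_congr _ H.isOpen hu (fun p hp => H.Gam_horizontal hp i j k) τ
  have z : ∀ (a : Fin 2) (j : Fin 3) (γ : Idx),
      (ansatz g1 g2 g3 h4 h5 w n).Gam (Sum.inr a) (Sum.inl j) γ = fun _ => 0 := by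
    intro a j γ; cases γ <;> rfl
  have z' : ∀ (i : Fin 3) (b : Fin 2) (γ : Idx),
      (ansatz g1 g2 g3 h4 h5 w n).Gam (Sum.inl i) (Sum.inr b) γ = fun _ => 0 := by
    intro a j γ; cases γ <;> rfl
  have an : ∀ (m i k : Fin 3),
      (ansatz g1 g2 g3 h4 h5 w n).anh (Sum.inl m) (Sum.inl i) (Sum.inl k) = fun _ => 0 := by
    intro m i k; rfl
  have an' : ∀ (m i : Fin 3) (c : Fin 2),
      (ansatz g1 g2 g3 h4 h5 w n).anh (Sum.inl m) (Sum.inl i) (Sum.inr c) = fun _ => 0 := by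
    intro m i k; rfl
  simp only [DMetric.ricci, DMetric.curv, Fintype.sum_sum_type, e, z, z', an, an',
    H.Gam_horizontal hu, H.Gam_horizontal_vertical hu, DMetric.delta_const]
  simp

/-- Every term contains either some `C^i_{jc}` or a vertical derivative of some `L^i_{jk}`, or else
a vanishing anholonomy coefficient. -/
theorem ricci_horizontal_vertical (H : IsRegularAnsatz U g1 g2 g3 h4 h5 w n) (hu : u ∈ U)
    (j : Fin 3) (c : Fin 2) :
    (ansatz g1 g2 g3 h4 h5 w n).ricci (Sum.inl j) (Sum.inr c) u = 0 := by
  have hU := H.isOpen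
  have p : ∀ i j k : Fin 3, pd (Sum.inr c) (horChristoffel g2 g3 i j k) u = 0 := by
    have z2 := H.z2 u hu
    have z3 := H.z3 u hu
    have D2 := differentiableAt_of_contDiffOn hU H.c2 hu
    have D3 := differentiableAt_of_contDiffOn hU H.c3 hu
    have E2 := fun α => differentiableAt_pd hU H.c2 hu α
    have E3 := fun α => differentiableAt_pd hU H.c3 hu α
    have a : pd (Sum.inr c) g2 u = 0 := H.pd_g2 hu (by simp)
    have b : pd (Sum.inr c) g3 u = 0 := H.pd_g3 hu (by simp)
    have aa : ∀ α, pd (Sum.inr c) (pd α g2) u = 0 := fun α =>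
      pd_pd_eq_zero_of_dependsOnlyOn hU H.c2 H.d2 hu (by simp) α
    have bb : ∀ α, pd (Sum.inr c) (pd α g3) u = 0 := fun α =>
      pd_pd_eq_zero_of_dependsOnlyOn hU H.c3 H.d3 hu (by simp) α
    intro i j k
    fin_cases i <;> fin_cases j <;> fin_cases k <;>
      simp [horChristoffel, pd_const, pd_neg, pd_div_two_mul, *]
  have e : ∀ (i j k : Fin 3), pd (Sum.inr c)
        ((ansatz g1 g2 g3 h4 h5 w n).Gam (Sum.inl i) (Sum.inl j) (Sum.inl k)) u = 0 :=
    fun i j k => (pd_congr hU hu (fun p hp => H.Gam_horizontal hp i j k) _).trans (p i j k)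
  have e' : ∀ (τ : Idx) (i j : Fin 3), (ansatz g1 g2 g3 h4 h5 w n).delta τ
        ((ansatz g1 g2 g3 h4 h5 w n).Gam (Sum.inl i) (Sum.inl j) (Sum.inr c)) u = 0 :=
    fun τ i j => (DMetric.delta_congr _ hU hu
      (fun p hp => H.Gam_horizontal_vertical hp i j c) τ).trans (DMetric.delta_const _ _ _ _)
  have z : ∀ (a : Fin 2) (j : Fin 3) (γ : Idx),
      (ansatz g1 g2 g3 h4 h5 w n).Gam (Sum.inr a) (Sum.inl j) γ = fun _ => 0 := by
    intro a j γ; cases γ <;> rfl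
  have z' : ∀ (i : Fin 3) (b : Fin 2) (γ : Idx),
      (ansatz g1 g2 g3 h4 h5 w n).Gam (Sum.inl i) (Sum.inr b) γ = fun _ => 0 := by
    intro a j γ; cases γ <;> rfl
  have an : ∀ (m i : Fin 3),
      (ansatz g1 g2 g3 h4 h5 w n).anh (Sum.inl m) (Sum.inr c) (Sum.inl i) = fun _ => 0 := by
    intro m i; rfl
  simp only [DMetric.ricci, DMetric.curv, Fintype.sum_sum_type, e', z, z', an,
    H.Gam_horizontal_vertical hu, DMetric.delta_const]
  simp [DMetric.delta, e]

/-- The fields `∂_a` commute, so no anholonomy term survives and the usual Ricci formula of the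
fibre metric is left. -/
theorem ricci_vertical_eq (H : IsRegularAnsatz U g1 g2 g3 h4 h5 w n) (hu : u ∈ U)
    (b c : Fin 2) :
    (ansatz g1 g2 g3 h4 h5 w n).ricci (Sum.inr b) (Sum.inr c) u
      = ∑ d, (pd (Sum.inr d) (verChristoffel h4 h5 d b c) u
        - pd (Sum.inr c) (verChristoffel h4 h5 d b d) u
        + ∑ e, (verChristoffel h4 h5 e b c u * verChristoffel h4 h5 d e d u
          - verChristoffel h4 h5 e b d u * verChristoffel h4 h5 d e c u)) := by
  have e : ∀ (τ : Idx) (d b c : Fin 2),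
      (ansatz g1 g2 g3 h4 h5 w n).delta τ
        ((ansatz g1 g2 g3 h4 h5 w n).Gam (Sum.inr d) (Sum.inr b) (Sum.inr c)) u
      = (ansatz g1 g2 g3 h4 h5 w n).delta τ (verChristoffel h4 h5 d b c) u := fun τ d b c =>
    DMetric.delta_congr _ H.isOpen hu (fun p hp => H.Gam_vertical hp d b c) τ
  have z : ∀ (a : Fin 2) (j : Fin 3) (γ : Idx),
      (ansatz g1 g2 g3 h4 h5 w n).Gam (Sum.inr a) (Sum.inl j) γ = fun _ => 0 := by
    intro a j γ; cases γ <;> rfl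
  have z' : ∀ (i : Fin 3) (b : Fin 2) (γ : Idx),
      (ansatz g1 g2 g3 h4 h5 w n).Gam (Sum.inl i) (Sum.inr b) γ = fun _ => 0 := by
    intro a j γ; cases γ <;> rfl
  have an : ∀ (φ : Idx) (c d : Fin 2),
      (ansatz g1 g2 g3 h4 h5 w n).anh φ (Sum.inr c) (Sum.inr d) = fun _ => 0 := by
    intro φ c d; cases φ <;> rfl
  have an' : ∀ (m i : Fin 3) (c : Fin 2),
      (ansatz g1 g2 g3 h4 h5 w n).anh (Sum.inl m) (Sum.inr c) (Sum.inl i) = fun _ => 0 := by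
    intro m i k; rfl
  simp only [DMetric.ricci, DMetric.curv, Fintype.sum_sum_type, e, z, z', an, an',
    H.Gam_vertical hu, DMetric.delta_const]
  simp [DMetric.delta]

/-- The last summand is the anholonomy: `δ_k ∂_d - ∂_d δ_k = (∂_d N_k^e) ∂_e`. -/
theorem ricci_vertical_horizontal_eq (H : IsRegularAnsatz U g1 g2 g3 h4 h5 w n) (hu : u ∈ U)
    (b : Fin 2) (k : Fin 3) :
    (ansatz g1 g2 g3 h4 h5 w n).ricci (Sum.inr b) (Sum.inl k) u
      = ∑ d, (pd (Sum.inr d) (mixedCoef h4 h5 w n k d b) u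
        - (ansatz g1 g2 g3 h4 h5 w n).delta (Sum.inl k) (verChristoffel h4 h5 d b d) u
        + ∑ e, (mixedCoef h4 h5 w n k e b u * verChristoffel h4 h5 d e d u
          - verChristoffel h4 h5 e b d u * mixedCoef h4 h5 w n k d e u
          + verChristoffel h4 h5 d b e u
            * pd (Sum.inr d) ((ansatz g1 g2 g3 h4 h5 w n).N e k) u)) := by
  have e : ∀ (τ : Idx) (d b c : Fin 2),
      (ansatz g1 g2 g3 h4 h5 w n).delta τ
        ((ansatz g1 g2 g3 h4 h5 w n).Gam (Sum.inr d) (Sum.inr b) (Sum.inr c)) u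
      = (ansatz g1 g2 g3 h4 h5 w n).delta τ (verChristoffel h4 h5 d b c) u := fun τ d b c =>
    DMetric.delta_congr _ H.isOpen hu (fun p hp => H.Gam_vertical hp d b c) τ
  have e' : ∀ (τ : Idx) (d b : Fin 2),
      (ansatz g1 g2 g3 h4 h5 w n).delta τ
        ((ansatz g1 g2 g3 h4 h5 w n).Gam (Sum.inr d) (Sum.inr b) (Sum.inl k)) u
      = (ansatz g1 g2 g3 h4 h5 w n).delta τ (mixedCoef h4 h5 w n k d b) u := fun τ d b =>
    DMetric.delta_congr _ H.isOpen hu (fun p hp => H.Gam_mixed hp d b k) τ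
  have z' : ∀ (i : Fin 3) (b : Fin 2) (γ : Idx),
      (ansatz g1 g2 g3 h4 h5 w n).Gam (Sum.inl i) (Sum.inr b) γ = fun _ => 0 := by
    intro a j γ; cases γ <;> rfl
  have an : ∀ (m : Fin 3) (d : Fin 2),
      (ansatz g1 g2 g3 h4 h5 w n).anh (Sum.inl m) (Sum.inl k) (Sum.inr d) = fun _ => 0 := by
    intro m d; rfl
  have an' : ∀ (c d : Fin 2),
      (ansatz g1 g2 g3 h4 h5 w n).anh (Sum.inr c) (Sum.inl k) (Sum.inr d)
        = pd (Sum.inr d) ((ansatz g1 g2 g3 h4 h5 w n).N c k) := by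
    intro m d; rfl
  simp only [DMetric.ricci, DMetric.curv, Fintype.sum_sum_type, e, e', z', an, an',
    H.Gam_vertical hu, H.Gam_mixed hu, DMetric.delta_const]
  simp [DMetric.delta]

theorem ricci_horizontal (H : IsRegularAnsatz U g1 g2 g3 h4 h5 w n) (hu : u ∈ U)
    (j k : Fin 3) :
    (ansatz g1 g2 g3 h4 h5 w n).ricci (Sum.inl j) (Sum.inl k) u
      = Matrix.diagonal ![0, g2 u * hExpr g2 g3 u, g3 u * hExpr g2 g3 u] j k := by
  have hU := H.isOpen
  have z2 := H.z2 u hu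
  have z3 := H.z3 u hu
  have D2 := differentiableAt_of_contDiffOn hU H.c2 hu
  have D3 := differentiableAt_of_contDiffOn hU H.c3 hu
  have E2 := fun α => differentiableAt_pd hU H.c2 hu α
  have E3 := fun α => differentiableAt_pd hU H.c3 hu α
  have a1 : pd x1 g2 u = 0 := H.pd_g2 hu (by simp)
  have b1 : pd x1 g3 u = 0 := H.pd_g3 hu (by simp)
  have a : ∀ c : Fin 2, pd (Sum.inr c) g2 u = 0 := fun c => H.pd_g2 hu (by simp)
  have b : ∀ c : Fin 2, pd (Sum.inr c) g3 u = 0 := fun c => H.pd_g3 hu (by simp)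
  have aa1 : ∀ α, pd x1 (pd α g2) u = 0 := fun α =>
    pd_pd_eq_zero_of_dependsOnlyOn hU H.c2 H.d2 hu (by simp) α
  have bb1 : ∀ α, pd x1 (pd α g3) u = 0 := fun α =>
    pd_pd_eq_zero_of_dependsOnlyOn hU H.c3 H.d3 hu (by simp) α
  have aa : ∀ (c : Fin 2) α, pd (Sum.inr c) (pd α g2) u = 0 := fun c α =>
    pd_pd_eq_zero_of_dependsOnlyOn hU H.c2 H.d2 hu (by simp) α
  have bb : ∀ (c : Fin 2) α, pd (Sum.inr c) (pd α g3) u = 0 := fun c α =>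
    pd_pd_eq_zero_of_dependsOnlyOn hU H.c3 H.d3 hu (by simp) α
  -- The mixed second derivatives must be put in one order for the off-diagonal components to
  -- cancel.
  have s2 := pd_comm hU H.c2 hu x3 x2
  have s3 := pd_comm hU H.c3 hu x3 x2
  rw [H.ricci_horizontal_eq hu]
  fin_cases j <;> fin_cases k <;>
    simp [Fin.sum_univ_three, DMetric.delta, horChristoffel, pd_const, pd_neg, pd_div_two_mul,
      hExpr, D2, D3, E2, E3, z2, z3, a1, b1, a, b, aa1, bb1, aa, bb, s2, s3] <;>
    field_simp <;> ring

theorem ricci_vertical (H : IsRegularAnsatz U g1 g2 g3 h4 h5 w n) (hu : u ∈ U)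
    (b c : Fin 2) :
    (ansatz g1 g2 g3 h4 h5 w n).ricci (Sum.inr b) (Sum.inr c) u
      = Matrix.diagonal ![h4 u * -(betaCoef h4 h5 u / (2 * h4 u * h5 u)),
          h5 u * -(betaCoef h4 h5 u / (2 * h4 u * h5 u))] b c := by
  have hU := H.isOpen
  have z4 := H.z4 u hu
  have z5 := H.z5 u hu
  have D4 := differentiableAt_of_contDiffOn hU H.c4 hu
  have D5 := differentiableAt_of_contDiffOn hU H.c5 hu
  have E4 := fun α => differentiableAt_pd hU H.c4 hu α
  have E5 := fun α => differentiableAt_pd hU H.c5 hu α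
  have a : pd y5 h4 u = 0 := pd_y5 H.isOpen H.c4 H.d4 hu
  have b' : pd y5 h5 u = 0 := pd_y5 H.isOpen H.c5 H.d5 hu
  have aa : ∀ α, pd y5 (pd α h4) u = 0 := fun α =>
    pd_pd_eq_zero_of_dependsOnlyOn hU H.c4 H.d4 hu (by simp) α
  have bb : ∀ α, pd y5 (pd α h5) u = 0 := fun α =>
    pd_pd_eq_zero_of_dependsOnlyOn hU H.c5 H.d5 hu (by simp) α
  rw [H.ricci_vertical_eq hu, betaCoef, pd_logDet _ D4 D5 z4 z5]
  fin_cases b <;> fin_cases c <;>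
    simp [verChristoffel, pd_const, pd_neg, pd_div_two_mul, D4, D5, E4, E5, z4, z5, a, b', aa,
      bb] <;>
    field_simp <;> ring

/-- The second derivatives of `h₄` drop out: `L^4_{4k}` and `C^4_{44}` are the `δ_k`- and
`∂_v`-derivatives of `ln √|h₄|`, and the commutator left by `∂_v L^4_{4k} - δ_k C^4_{44}` is
cancelled by the anholonomy term. What remains is `-1/(2h₅)` times `δ_k h₅^* - h₅^* δ_k ln √|h₄
h₅|`; splitting `δ_k` into `∂_k - w_k ∂_v` gives `α_k` and `w_k β`. -/
theorem ricci_y4_horizontal (H : IsRegularAnsatz U g1 g2 g3 h4 h5 w n) (hu : u ∈ U)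
    (k : Fin 3) :
    (ansatz g1 g2 g3 h4 h5 w n).ricci y4 (Sum.inl k) u
      = w k u * (betaCoef h4 h5 u / (2 * h5 u)) - alphaCoef h4 h5 k u / (2 * h5 u) := by
  have hU := H.isOpen
  have z4 := H.z4 u hu
  have z5 := H.z5 u hu
  have D4 := differentiableAt_of_contDiffOn hU H.c4 hu
  have D5 := differentiableAt_of_contDiffOn hU H.c5 hu
  have E4 := fun α => differentiableAt_pd hU H.c4 hu α
  have E5 := fun α => differentiableAt_pd hU H.c5 hu α
  have Dw := differentiableAt_of_contDiffOn hU (H.cw k) hu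
  have En := fun α => differentiableAt_pd hU (H.cn k) hu α
  have a : pd y5 h4 u = 0 := pd_y5 H.isOpen H.c4 H.d4 hu
  have b : pd y5 h5 u = 0 := pd_y5 H.isOpen H.c5 H.d5 hu
  have w5 : pd y5 (w k) u = 0 := pd_y5 H.isOpen (H.cw k) (H.dw k) hu
  have n5 : pd y5 (n k) u = 0 := pd_y5 H.isOpen (H.cn k) (H.dn k) hu
  have aa : ∀ α, pd y5 (pd α h4) u = 0 := fun α =>
    pd_pd_eq_zero_of_dependsOnlyOn hU H.c4 H.d4 hu (by simp) α
  have bb : ∀ α, pd y5 (pd α h5) u = 0 := fun α =>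
    pd_pd_eq_zero_of_dependsOnlyOn hU H.c5 H.d5 hu (by simp) α
  have nn : ∀ α, pd y5 (pd α (n k)) u = 0 := fun α =>
    pd_pd_eq_zero_of_dependsOnlyOn hU (H.cn k) (H.dn k) hu (by simp) α
  have s4 := pd_comm hU H.c4 hu y4 (Sum.inl k)
  -- This is `∂_v L^4_{4k}`; `s4` orders the mixed derivative of `h4` as it occurs in `δ_k
  -- C^4_{44}`.
  have q : pd y4 (fun p => (pd (Sum.inl k) h4 p - w k p * pd y4 h4 p) / (2 * h4 p)) u
      = (pd (Sum.inl k) (pd y4 h4) u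
          - (w k u * pd y4 (pd y4 h4) u + pd y4 (w k) u * pd y4 h4 u)) / (2 * h4 u)
        - (pd (Sum.inl k) h4 u - w k u * pd y4 h4 u) * pd y4 h4 u / (2 * h4 u ^ 2) := by
    rw [pd_div_two_mul _ ((E4 _).fun_sub (Dw.fun_mul (E4 _))) D4 z4,
      pd_sub _ (E4 _) (Dw.fun_mul (E4 _)), pd_mul _ Dw (E4 _), s4]
  rw [H.ricci_vertical_horizontal_eq hu, betaCoef, alphaCoef, pd_logDet _ D4 D5 z4 z5,
    pd_logDet _ D4 D5 z4 z5]
  simp [DMetric.delta, mixedCoef, verChristoffel, q, ansatz, pd_div_two_mul,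
    pd_const_mul, D4, D5, E4, E5, En, z4, z5, a, b, w5, n5, aa, bb, nn]
  field_simp
  ring

/-- The term `n_k^{**}` comes from `∂_v L^4_{5k}`, with `L^4_{5k} = -h₅ n_k^*/(2h₄)`. The terms in
`n_k^*` from this derivative, the quadratic products and the anholonomy add up to `γ`. -/
theorem ricci_y5_horizontal (H : IsRegularAnsatz U g1 g2 g3 h4 h5 w n) (hu : u ∈ U)
    (k : Fin 3) :
    (ansatz g1 g2 g3 h4 h5 w n).ricci y5 (Sum.inl k) u
      = -(h5 u / (2 * h4 u)) *
        (pd y4 (pd y4 (n k)) u + gammaCoef h4 h5 u * pd y4 (n k) u) := by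
  have hU := H.isOpen
  have z4 := H.z4 u hu
  have z5 := H.z5 u hu
  have D4 := differentiableAt_of_contDiffOn hU H.c4 hu
  have D5 := differentiableAt_of_contDiffOn hU H.c5 hu
  have E5 := fun α => differentiableAt_pd hU H.c5 hu α
  have Dw := differentiableAt_of_contDiffOn hU (H.cw k) hu
  have En := fun α => differentiableAt_pd hU (H.cn k) hu α
  have b : pd y5 h5 u = 0 := pd_y5 H.isOpen H.c5 H.d5 hu
  have w5 : pd y5 (w k) u = 0 := pd_y5 H.isOpen (H.cw k) (H.dw k) hu
  have n5 : pd y5 (n k) u = 0 := pd_y5 H.isOpen (H.cn k) (H.dn k) hu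
  have bb : ∀ α, pd y5 (pd α h5) u = 0 := fun α =>
    pd_pd_eq_zero_of_dependsOnlyOn hU H.c5 H.d5 hu (by simp) α
  have q : pd y4 (fun p => (h5 p * pd y4 (n k) p) / (2 * h4 p)) u
      = (h5 u * pd y4 (pd y4 (n k)) u + pd y4 h5 u * pd y4 (n k) u) / (2 * h4 u)
        - h5 u * pd y4 (n k) u * pd y4 h4 u / (2 * h4 u ^ 2) := by
    rw [pd_div_two_mul _ (D5.fun_mul (En _)) D4 z4, pd_mul _ D5 (En _)]
  have q' : pd y5 (fun p => (pd (Sum.inl k) h5 p - w k p * pd y4 h5 p) / (2 * h5 p)) u = 0 := by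
    rw [pd_div_two_mul _ ((E5 _).fun_sub (Dw.fun_mul (E5 _))) D5 z5,
      pd_sub _ (E5 _) (Dw.fun_mul (E5 _)), pd_mul _ Dw (E5 _), bb, bb, w5, b]
    simp
  rw [H.ricci_vertical_horizontal_eq hu, gammaCoef]
  simp [DMetric.delta, mixedCoef, verChristoffel, q, q', ansatz, pd_const, pd_neg, w5, n5]
  field_simp
  ring

end IsRegularAnsatz

end AnholonomicGravity

namespace AnholonomicGravity

/-! ### The reduced system -/

namespace IsRegularAnsatz

variable {U : Set Pt} {g1 : ℝ} {g2 g3 h4 h5 : Pt → ℝ} {w n : Fin 3 → Pt → ℝ} {u : Pt}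

theorem ricciUp_eq (H : IsRegularAnsatz U g1 g2 g3 h4 h5 w n) (hu : u ∈ U) :
    (ansatz g1 g2 g3 h4 h5 w n).ricciUp x2 x2 u = hExpr g2 g3 u ∧
    (ansatz g1 g2 g3 h4 h5 w n).ricciUp x3 x3 u = hExpr g2 g3 u ∧
    (ansatz g1 g2 g3 h4 h5 w n).ricciUp y4 y4 u = -(betaCoef h4 h5 u / (2 * h4 u * h5 u)) ∧
    (ansatz g1 g2 g3 h4 h5 w n).ricciUp y5 y5 u = -(betaCoef h4 h5 u / (2 * h4 u * h5 u)) := by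
  have z2 := H.z2 u hu
  have z3 := H.z3 u hu
  have z4 := H.z4 u hu
  have z5 := H.z5 u hu
  refine ⟨?_, ?_, ?_, ?_⟩ <;>
    simp only [DMetric.ricciUp, DMetric.invMetric, H.inv_g hu, H.inv_h hu,
      Fintype.sum_sum_type, Matrix.fromBlocks_apply₁₁, Matrix.fromBlocks_apply₁₂,
      Matrix.fromBlocks_apply₂₁, Matrix.fromBlocks_apply₂₂, H.ricci_horizontal hu,
      H.ricci_vertical hu] <;>
    simp [Fin.sum_univ_three, z2, z3, z4, z5]

theorem scalarCurv_eq (H : IsRegularAnsatz U g1 g2 g3 h4 h5 w n) (hu : u ∈ U) :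
    (ansatz g1 g2 g3 h4 h5 w n).scalarCurv u
      = 2 * hExpr g2 g3 u + 2 * -(betaCoef h4 h5 u / (2 * h4 u * h5 u)) := by
  have z2 := H.z2 u hu
  have z3 := H.z3 u hu
  have z4 := H.z4 u hu
  have z5 := H.z5 u hu
  simp only [DMetric.scalarCurv, DMetric.invMetric, H.inv_g hu, H.inv_h hu,
    Fintype.sum_sum_type, Matrix.fromBlocks_apply₁₁, Matrix.fromBlocks_apply₁₂,
    Matrix.fromBlocks_apply₂₁, Matrix.fromBlocks_apply₂₂, H.ricci_horizontal hu,
    H.ricci_vertical hu]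
  simp [Fin.sum_univ_three, z2, z3, z4, z5]
  ring

theorem sourceUp_eq (H : IsRegularAnsatz U g1 g2 g3 h4 h5 w n) (hu : u ∈ U)
    (T : Idx → Idx → Pt → ℝ) :
    (ansatz g1 g2 g3 h4 h5 w n).sourceUp T x1 x1 u = g1⁻¹ * T x1 x1 u ∧
    (ansatz g1 g2 g3 h4 h5 w n).sourceUp T x2 x2 u = (g2 u)⁻¹ * T x2 x2 u ∧
    (ansatz g1 g2 g3 h4 h5 w n).sourceUp T x3 x3 u = (g3 u)⁻¹ * T x3 x3 u ∧
    (ansatz g1 g2 g3 h4 h5 w n).sourceUp T y4 y4 u = (h4 u)⁻¹ * T y4 y4 u ∧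
    (ansatz g1 g2 g3 h4 h5 w n).sourceUp T y5 y5 u = (h5 u)⁻¹ * T y5 y5 u := by
  refine ⟨?_, ?_, ?_, ?_, ?_⟩ <;>
    simp only [DMetric.sourceUp, DMetric.invMetric, H.inv_g hu, H.inv_h hu,
      Fintype.sum_sum_type, Matrix.fromBlocks_apply₁₁, Matrix.fromBlocks_apply₁₂,
      Matrix.fromBlocks_apply₂₁, Matrix.fromBlocks_apply₂₂] <;>
    simp [Fin.sum_univ_three]

/-- `R_{11}` and `R_{ia}` vanish identically, and each two-dimensional block is a nonzero metric
coefficient times one scalar, so the reduced system omits no equation. -/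
theorem vacuumEq_iff (H : IsRegularAnsatz U g1 g2 g3 h4 h5 w n) (hu : u ∈ U) :
    (ansatz g1 g2 g3 h4 h5 w n).VacuumEq u
      ↔ (ansatz g1 g2 g3 h4 h5 w n).ReducedSystem 0 0 u := by
  have z2 := H.z2 u hu
  have z4 := H.z4 u hu
  obtain ⟨e2, e3, e4, e5⟩ := H.ricciUp_eq hu
  simp only [DMetric.VacuumEq, DMetric.ReducedSystem, e2, e3, e4, e5, neg_zero]
  constructor
  · intro h
    have k := h x2 x2
    have s := h y4 y4
    rw [H.ricci_horizontal hu] at k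
    rw [H.ricci_vertical hu] at s
    have k' : g2 u * hExpr g2 g3 u = 0 := by simpa using k
    have s' : h4 u * -(betaCoef h4 h5 u / (2 * h4 u * h5 u)) = 0 := s
    have k0 := (mul_eq_zero.mp k').resolve_left z2
    have s0 := (mul_eq_zero.mp s').resolve_left z4
    exact ⟨⟨k0, k0⟩, ⟨s0, s0⟩, fun i => h _ _, fun i => h _ _⟩
  · rintro ⟨⟨k, -⟩, ⟨s, -⟩, r4, r5⟩ (i | a) (j | b)
    · rw [H.ricci_horizontal hu, k]
      fin_cases i <;> fin_cases j <;> simp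
    · exact H.ricci_horizontal_vertical hu i b
    · fin_cases a
      · exact r4 j
      · exact r5 j
    · rw [H.ricci_vertical hu, s]
      fin_cases a <;> fin_cases b <;> simp

/-- For a diagonal source the Einstein equations amount to the five diagonal ones, written with
mixed components, and `R_{4i} = R_{5i} = 0`. -/
theorem einsteinEq_iff (H : IsRegularAnsatz U g1 g2 g3 h4 h5 w n) (hu : u ∈ U) (κ : ℝ)
    (T : Idx → Idx → Pt → ℝ) (hT : ∀ α β, α ≠ β → T α β u = 0) :
    (ansatz g1 g2 g3 h4 h5 w n).EinsteinEq κ T u ↔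
      (-(hExpr g2 g3 u + -(betaCoef h4 h5 u / (2 * h4 u * h5 u)))
          = κ * (ansatz g1 g2 g3 h4 h5 w n).sourceUp T x1 x1 u ∧
        betaCoef h4 h5 u / (2 * h4 u * h5 u)
          = κ * (ansatz g1 g2 g3 h4 h5 w n).sourceUp T x2 x2 u ∧
        betaCoef h4 h5 u / (2 * h4 u * h5 u)
          = κ * (ansatz g1 g2 g3 h4 h5 w n).sourceUp T x3 x3 u ∧
        -hExpr g2 g3 u = κ * (ansatz g1 g2 g3 h4 h5 w n).sourceUp T y4 y4 u ∧
        -hExpr g2 g3 u = κ * (ansatz g1 g2 g3 h4 h5 w n).sourceUp T y5 y5 u) ∧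
      (∀ i : Fin 3, (ansatz g1 g2 g3 h4 h5 w n).ricci y4 (Sum.inl i) u = 0) ∧
      (∀ i : Fin 3, (ansatz g1 g2 g3 h4 h5 w n).ricci y5 (Sum.inl i) u = 0) := by
  have z1 := H.z1
  have z2 := H.z2 u hu
  have z3 := H.z3 u hu
  have z4 := H.z4 u hu
  have z5 := H.z5 u hu
  obtain ⟨t1, t2, t3, t4, t5⟩ := H.sourceUp_eq hu T
  rw [t1, t2, t3, t4, t5]
  simp only [DMetric.EinsteinEq, H.scalarCurv_eq hu]
  generalize hK : hExpr g2 g3 u = K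
  -- With this sign `S^4_4 = S^5_5 = -S`, so the scalar curvature is `2K - 2S`.
  generalize hS : betaCoef h4 h5 u / (2 * h4 u * h5 u) = S
  have rh := H.ricci_horizontal hu
  have rv := H.ricci_vertical hu
  rw [hK] at rh
  rw [hS] at rv
  -- Multiplying by the diagonal metric coefficient turns each mixed equation into the one with
  -- lowered indices.
  have lower : ∀ {z X t : ℝ}, z ≠ 0 → (X = κ * (z⁻¹ * t) ↔ z * X = κ * t) := by
    intro z X t hz
    rw [show κ * (z⁻¹ * t) = κ * t / z by ring, eq_div_iff hz, mul_comm]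
  rw [lower z1, lower z2, lower z3, lower z4, lower z5]
  constructor
  · intro h
    refine ⟨⟨?_, ?_, ?_, ?_, ?_⟩, fun i => ?_, fun i => ?_⟩
    · have e := h x1 x1
      rw [rh] at e
      simp [DMetric.metric, ansatz] at e
      linarith
    · have e := h x2 x2
      rw [rh] at e
      simp [DMetric.metric, ansatz] at e
      linarith
    · have e := h x3 x3
      rw [rh] at e
      simp [DMetric.metric, ansatz] at e
      linarith
    · have e := h y4 y4
      rw [rv] at e
      simp [DMetric.metric, ansatz] at e
      linarith
    · have e := h y5 y5
      rw [rv] at e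
      simp [DMetric.metric, ansatz] at e
      linarith
    · simpa [DMetric.metric, hT y4 (Sum.inl i) (by simp)] using h y4 (Sum.inl i)
    · simpa [DMetric.metric, hT y5 (Sum.inl i) (by simp)] using h y5 (Sum.inl i)
  · rintro ⟨⟨e1, e2, e3, e4, e5⟩, r4, r5⟩ (i | a) (j | b)
    · rw [rh]
      by_cases hij : i = j
      · subst hij
        fin_cases i <;> simp [DMetric.metric, ansatz] <;> linarith
      · simp [DMetric.metric, ansatz, hij, hT (Sum.inl i) (Sum.inl j) (by simpa using hij)]
    · simp [DMetric.metric, H.ricci_horizontal_vertical hu, hT (Sum.inl i) (Sum.inr b) (by simp)]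
    · have r : (ansatz g1 g2 g3 h4 h5 w n).ricci (Sum.inr a) (Sum.inl j) u = 0 := by
        fin_cases a
        · exact r4 j
        · exact r5 j
      simp [DMetric.metric, r, hT (Sum.inr a) (Sum.inl j) (by simp)]
    · rw [rv]
      by_cases hab : a = b
      · subst hab
        fin_cases a <;> simp [DMetric.metric, ansatz] <;> linarith
      · simp [DMetric.metric, ansatz, hab, hT (Sum.inr a) (Sum.inr b) (by simpa using hab)]

end IsRegularAnsatz

end AnholonomicGravity

theorem corollary2
    (U : Set Pt) (hU : IsOpen U)
    (g1 : ℝ) (hg1 : g1 = 1 ∨ g1 = -1)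
    (g2 g3 h4 h5 : Pt → ℝ) (w n : Fin 3 → Pt → ℝ)
    -- regularity
    (hg2 : ContDiffOn ℝ 2 g2 U) (hg3 : ContDiffOn ℝ 2 g3 U)
    (hh4 : ContDiffOn ℝ 2 h4 U) (hh5 : ContDiffOn ℝ 2 h5 U)
    (hw : ∀ i, ContDiffOn ℝ 2 (w i) U) (hn : ∀ i, ContDiffOn ℝ 2 (n i) U)
    -- g₂, g₃ are functions of (x², x³); h₄, h₅, w_i, n_i are functions of (x¹, x², x³, v)
    (dg2 : DependsOnlyOn U g2 {x2, x3}) (dg3 : DependsOnlyOn U g3 {x2, x3})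
    (dh4 : DependsOnlyOn U h4 {x1, x2, x3, y4}) (dh5 : DependsOnlyOn U h5 {x1, x2, x3, y4})
    (dw : ∀ i, DependsOnlyOn U (w i) {x1, x2, x3, y4})
    (dn : ∀ i, DependsOnlyOn U (n i) {x1, x2, x3, y4})
    -- nondegeneracy
    (zg2 : ∀ u ∈ U, g2 u ≠ 0) (zg3 : ∀ u ∈ U, g3 u ≠ 0)
    (zh4 : ∀ u ∈ U, h4 u ≠ 0) (zh5 : ∀ u ∈ U, h5 u ≠ 0)
    (M : DMetric) (hM : M = ansatz g1 g2 g3 h4 h5 w n) :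
    -- the explicit left-hand sides of the reduced system
    (∀ u ∈ U,
      M.ricciUp x2 x2 u = hExpr g2 g3 u ∧ M.ricciUp x3 x3 u = hExpr g2 g3 u ∧
      M.ricciUp y4 y4 u = -(betaCoef h4 h5 u / (2 * h4 u * h5 u)) ∧
      M.ricciUp y5 y5 u = -(betaCoef h4 h5 u / (2 * h4 u * h5 u)) ∧
      (∀ i : Fin 3, M.ricci y4 (Sum.inl i) u =
        w i u * (betaCoef h4 h5 u / (2 * h5 u)) - alphaCoef h4 h5 i u / (2 * h5 u)) ∧
      (∀ i : Fin 3, M.ricci y5 (Sum.inl i) u =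
        -(h5 u / (2 * h4 u)) * (pd y4 (pd y4 (n i)) u + gammaCoef h4 h5 u * pd y4 (n i) u))) ∧
    -- the vacuum system
    (∀ u ∈ U, M.VacuumEq u ↔ M.ReducedSystem 0 0 u) ∧
    -- its extension to diagonal matter sources
    (∀ (κ : ℝ) (T : Idx → Idx → Pt → ℝ),
      (∀ u ∈ U, ∀ α β, α ≠ β → T α β u = 0) →
        (∀ u ∈ U, M.SourceCond T u →
          (M.EinsteinEq κ T u ↔
            M.ReducedSystem (κ * M.sourceUp T x2 x2 u) (κ * M.sourceUp T y4 y4 u) u)) ∧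
        (κ ≠ 0 → ∀ u ∈ U, M.EinsteinEq κ T u → M.SourceCond T u)) := by
  have H : IsRegularAnsatz U g1 g2 g3 h4 h5 w n :=
    { isOpen := hU
      z1 := by rcases hg1 with h | h <;> simp [h]
      c2 := hg2, c3 := hg3, c4 := hh4, c5 := hh5, cw := hw, cn := hn
      d2 := dg2, d3 := dg3, d4 := dh4, d5 := dh5, dw := dw, dn := dn
      z2 := zg2, z3 := zg3, z4 := zh4, z5 := zh5 }
  subst hM
  refine ⟨fun u hu => ?_, fun u hu => H.vacuumEq_iff hu, fun κ T hT => ⟨fun u hu hc => ?_,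
    fun hκ u hu hE => ?_⟩⟩
  · obtain ⟨e2, e3, e4, e5⟩ := H.ricciUp_eq hu
    exact ⟨e2, e3, e4, e5, H.ricci_y4_horizontal hu, H.ricci_y5_horizontal hu⟩
  · obtain ⟨e2, e3, e4, e5⟩ := H.ricciUp_eq hu
    obtain ⟨c1, c2, c3⟩ := hc
    -- The source conditions express every diagonal source through `Υ^2_2` and `Υ^4_4`; the `x¹`
    -- equation is then the sum of the other two.
    rw [H.einsteinEq_iff hu κ T (hT u hu), DMetric.ReducedSystem, e2, e3, e4, e5, c1, ← c2, ← c3]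
    constructor
    · rintro ⟨⟨-, s, -, k, -⟩, r⟩
      exact ⟨⟨by linarith, by linarith⟩, ⟨by linarith, by linarith⟩, r⟩
    · rintro ⟨⟨k, -⟩, ⟨s, -⟩, r⟩
      exact ⟨⟨by linarith, by linarith, by linarith, by linarith, by linarith⟩, r⟩
  · obtain ⟨⟨e1, e2, e3, e4, e5⟩, -⟩ := (H.einsteinEq_iff hu κ T (hT u hu)).mp hE
    -- The left-hand sides satisfy the three relations identically, so the sources do so after
    -- multiplication by `κ`.
    exact ⟨mul_left_cancel₀ hκ (by linarith), mul_left_cancel₀ hκ (by linarith),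
      mul_left_cancel₀ hκ (by linarith)⟩
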